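/- Let $X$ and $S$ be nonempty finite sets and let $\mathcal A=(X,S,\pi,\lambda)$ be a Mealy automaton with transition function $\pi:S\times X\to S$ and output function $\lambda:S\times X\to X$. Extend $\pi$ to words by $\pi(s,\varnothing)=s$, $\pi(s,xw)=\pi(\pi(s,x),w)$. The transformation $g:X^{\mathbb N}\to X^{\mathbb N}$ generated by $\mathcal A$ with initial state $g\in S$ is $g(\omega)=\lambda(g,\omega)$, where $\lambda(s,x\omega)=\lambda(s,x)\,\lambda(\pi(s,x),\omega)$ for $s\in S$, $x\in X$, $\omega\in X^{\mathbb N}$. The Moore diagram of $\mathcal A$ is the directed graph with vertex set $S$ and labeled edges $s\xrightarrow{x|y}s'$, where $\pi(s,x)=s'$ and $\lambda(s,x)=y$. Let $L=(L_{xy})_{x,y\in X}$ be an irreducible stochastic matrix (nonnegative entries, rows summing to $1$), let $\boldsymbol l$ be its stationary probability vector ($\boldsymbol l L=\boldsymbol l$), and let $\mu$ be the corresponding Markov measure, that is, the Borel probability measure on $X^{\mathbb N}$ with $$\mu(x_1x_2\ldots x_nX^{\mathbb N})=\boldsymbol l_{x_1}L_{x_1x_2}\cdots L_{x_{n-1}x_n}\qquad(n\ge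 1,\ x_1,\dots,x_n\in X).$$ Assume that $\mathcal A$ is $L$-strongly connected: for all $s,r\in S$ and $x,y\in X$ there is a (possibly empty) word $w$ over $X$ such that $\pi(s,xw)=r$ and $L_{ab}\neq0$ for any two consecutive letters $a,b$ of the word $xwy$. Let $T=T_{L,\mathcal A}$ be the stochastic matrix with rows and columns indexed by $S\times X$ given by $T_{(s_0,x_0)(s_1,x_1)}=L_{x_0x_1}$ if $\pi(s_0,x_0)=s_1$, and $T_{(s_0,x_0)(s_1,x_1)}=0$ otherwise. Then $T$ has a unique stationary probability vector $\boldsymbol t$, and for any state $g\in S$, any nonempty word $u=u_1u_2\ldots u_k$ over $X$ and $\mu$-almost all $\omega\in X^{\mathbb N}$ the asymptotic frequency of $u$ in $g(\omega)$ exists and is given by $$\lim_{n\to\infty}\frac1n\sum_{i=0}^{n-1}\chi_{uX^{\mathbb N}}(\sigma^i g(\omega))=\sum_{s_0\xrightarrow{x_0|u_1}s_1\cdots\xrightarrow{x_{k-1}|u_k}s_k}\boldsymbol t_{(s_0,x_0)}L_{x_0x_1}\cdots L_{x_{k-2}x_{k-1}},$$ where $\sigma$ is the shift, $\chi_{uX^{\mathbb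 N}}$ is the characteristic function of the set of sequences with prefix $u$, and the sum is over all paths in the Moore diagram of $\mathcal A$ with output $u$. -/

import Mathlib

open MeasureTheory Filter Topology

noncomputable section

/-- The one-sided shift on infinite sequences. -/
def seqShift {X : Type*} (ω : ℕ → X) : ℕ → X := fun n => ω (n + 1)

/-- The cylinder `u X^ℕ`: all infinite sequences that have the finite word `u` as a prefix. -/
def wordCylinder {X : Type*} {k : ℕ} (u : Fin k → X) : Set (ℕ → X) :=
  {ω | ∀ i : Fin k, ω i = u i}

/-- The word `u` occurs in the sequence `ω` with asymptotic frequency `a`: the limit of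
`(1/n) ∑_{i<n} χ_{uX^ℕ}(σ^i ω)` exists and equals `a`. -/
def HasWordFreq {X : Type*} {k : ℕ} (ω : ℕ → X) (u : Fin k → X) (a : ℝ) : Prop :=
  Tendsto
    (fun n : ℕ => birkhoffAverage ℝ seqShift ((wordCylinder u).indicator (fun _ => (1 : ℝ))) n ω)
    atTop (𝓝 a)

/-- `t` is a stationary probability (row) vector of the matrix `M`. -/
structure IsStationaryProbVec {I : Type*} [Fintype I] (M : Matrix I I ℝ) (t : I → ℝ) : Prop where
  nonneg : ∀ i, 0 ≤ t i
  sum_eq_one : ∑ i, t i = 1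
  stationary : Matrix.vecMul t M = t

/-- `L_{x₀x₁} L_{x₁x₂} ⋯ L_{x_{m-1}x_m}` for the word `x₀ x₁ … x_m`. -/
def transitionWeight {X : Type*} (L : Matrix X X ℝ) {m : ℕ} (x : Fin (m + 1) → X) : ℝ :=
  ∏ i : Fin m, L (x i.castSucc) (x i.succ)

/-- `μ` is the Markov measure with initial probability vector `l` and transition matrix `L`,
given by its values on the cylinders. -/
def IsMarkovMeasure {X : Type*} [MeasurableSpace X] (l : X → ℝ) (L : Matrix X X ℝ)
    (μ : Measure (ℕ → X)) : Prop :=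
  ∀ (m : ℕ) (x : Fin (m + 1) → X),
    μ (wordCylinder x) = ENNReal.ofReal (l (x 0) * transitionWeight L x)

/-- A Mealy automaton with input/output alphabet `X` and set of states `S`. -/
structure MealyAutomaton (X S : Type*) where
  /-- the transition function -/
  trans : S → X → S
  /-- the output function -/
  out : S → X → X

namespace MealyAutomaton

/-- The transition function extended to finite words. -/
def transWord {X S : Type*} (A : MealyAutomaton X S) : S → List X → S
  | s, [] => s
  | s, x :: w => A.transWord (A.trans s x) w

/-- The transformation of `X^ℕ` generated by the automaton with initial state `s`, defined by
`λ(s, xω) = λ(s, x) λ(π(s, x), ω)`. -/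
def act {X S : Type*} (A : MealyAutomaton X S) : S → (ℕ → X) → ℕ → X
  | s, ω, 0 => A.out s (ω 0)
  | s, ω, n + 1 => A.act (A.trans s (ω 0)) (seqShift ω) n

/-- `L`-strong connectedness: for all states `s`, `r` and letters `x`, `y` there is a (possibly
empty) word `w` with `π(s, xw) = r` such that all transitions in the word `xwy` are allowed
by `L`. -/
def LStronglyConnected {X S : Type*} (A : MealyAutomaton X S) (L : Matrix X X ℝ) : Prop :=
  ∀ (s r : S) (x y : X), ∃ w : List X,
    A.transWord s (x :: w) = r ∧ (x :: (w ++ [y])).IsChain (fun a b => L a b ≠ 0)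

/-- The skew-product matrix `T_{L,A}` indexed by `S × X`. -/
def skewMatrix {X S : Type*} [DecidableEq S] (A : MealyAutomaton X S) (L : Matrix X X ℝ) :
    Matrix (S × X) (S × X) ℝ :=
  Matrix.of fun p q => if A.trans p.1 p.2 = q.1 then L p.2 q.2 else 0

/-- The labels and vertices `s₀ --x₀|u₁--> s₁ --x₁|u₂--> ⋯ --x_{k-1}|u_k--> s_k` form a path in
the Moore diagram of the automaton. -/
def IsMoorePath {X S : Type*} (A : MealyAutomaton X S) {k : ℕ} (s : Fin (k + 1) → S)
    (x u : Fin k → X) : Prop :=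
  ∀ i : Fin k, A.trans (s i.castSucc) (x i) = s i.succ ∧ A.out (s i.castSucc) (x i) = u i

open Classical in
/-- The sum of `t_{(s₀,x₀)} L_{x₀x₁} ⋯ L_{x_{k-2}x_{k-1}}` over all paths in the Moore diagram
whose output is the nonempty word `u` of length `k = m + 1`. -/
def moorePathSum {X S : Type*} [Fintype X] [Fintype S] (A : MealyAutomaton X S)
    (L : Matrix X X ℝ) (t : S × X → ℝ) {m : ℕ} (u : Fin (m + 1) → X) : ℝ :=
  ∑ p : (Fin (m + 2) → S) × (Fin (m + 1) → X) with A.IsMoorePath p.1 p.2 u,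
    t (p.1 0, p.2 0) * transitionWeight L p.2

end MealyAutomaton

end

/-! While the automaton reads a `μ`-random sequence, the pair (current state, next input letter) is
a Markov chain on `S × X` with transition matrix `T`. `L`-strong connectedness makes every
configuration reachable from every other, so functions harmonic for `T` are constant
(`harmonic_const`). Hence the Poisson equation `f - t ⬝ᵥ f = h - T h` is solvable
(`exists_poisson`), which gives uniqueness of `t`.

No ergodic theorem is needed. The variables `h (c (n+1)) - (T h) (c n)` along the configurations `c
n` are bounded martingale differences, whatever the initial letter distribution, and an elementary
strong law for bounded orthogonal variables sends their averages to zero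
(`ae_tendsto_average_increment`). With the Poisson equation, averages of `f (c n)` tend to `t ⬝ᵥ f`
(`ae_tendsto_average_config`).

Whether `u` occurs in the output at time `i` depends on several future letters. Its indicator
differs from `outputProb` at `c i`, the conditional probability of `u`, by finitely many weighted
martingale differences (`ae_tendsto_average_occurrence`). Thus the frequency is `t ⬝ᵥ outputProb`,
which is the sum over Moore paths (`moorePathSum_eq_sum`). -/

/-- A set of indices that is closed under the transitions of `T` is empty or everything. -/
def Matrix.OnlyTrivialClosed {I : Type*} (T : Matrix I I ℝ) : Prop :=
  ∀ P : I → Prop, (∀ p q, P p → T p q ≠ 0 → P q) → ∀ p q, P p → P q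

/-! ### Finite stochastic matrices: harmonic functions, the Poisson equation, stationary vectors. -/

section StochasticMatrix

variable {I : Type*} [Fintype I] [DecidableEq I] {T : Matrix I I ℝ}

/-- Maximum principle: an average of values of `h` can equal the maximum only if every value with
positive weight does, so the set where the maximum is attained is closed under transitions. -/
theorem Matrix.OnlyTrivialClosed.harmonic_const (hc : T.OnlyTrivialClosed)
    (hT : T ∈ Matrix.rowStochastic ℝ I) {h : I → ℝ} (hh : T.mulVec h = h) (p q : I) :
    h p = h q := by
  have : Nonempty I := ⟨p⟩
  obtain ⟨m, hm⟩ := Finite.exists_max h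
  have key : ∀ q, h q = h m := by
    intro q
    refine hc (fun q => h q = h m) ?_ m q rfl
    intro a b ha hab
    by_contra hne
    have hlt : h b < h m := lt_of_le_of_ne (hm b) hne
    have h1 : ∑ c, T a c * h c < ∑ c, T a c * h m := by
      refine Finset.sum_lt_sum
        (fun c _ => mul_le_mul_of_nonneg_left (hm c) (Matrix.nonneg_of_mem_rowStochastic hT))
        ⟨b, Finset.mem_univ b, mul_lt_mul_of_pos_left hlt ?_⟩
      exact lt_of_le_of_ne (Matrix.nonneg_of_mem_rowStochastic hT) (Ne.symm hab)
    rw [← Finset.sum_mul, Matrix.sum_row_of_mem_rowStochastic hT, one_mul] at h1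
    have h2 := congrFun hh a
    simp only [Matrix.mulVec, dotProduct] at h2
    exact h1.ne (h2.trans ha)
  rw [key p, key q]

omit [DecidableEq I] in
theorem IsStationaryProbVec.dotProduct_mulVec {t : I → ℝ} (ht : IsStationaryProbVec T t)
    (h : I → ℝ) : t ⬝ᵥ T.mulVec h = t ⬝ᵥ h := by
  rw [Matrix.dotProduct_mulVec, ht.stationary]

/-- Solvability of the Poisson equation. -/
theorem Matrix.OnlyTrivialClosed.exists_poisson (hc : T.OnlyTrivialClosed)
    (hT : T ∈ Matrix.rowStochastic ℝ I) {t : I → ℝ} (ht : IsStationaryProbVec T t) (f : I → ℝ) :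
    ∃ h : I → ℝ, ∀ p, f p - t ⬝ᵥ f = h p - T.mulVec h p := by
  -- `1 - T` has the constants as kernel, and `t` annihilates its range. Adding the rank-one term `t
  -- ⬝ᵥ f` makes the map injective, hence surjective in finite dimension, and it preserves the
  -- pairing with `t`.
  let K : (I → ℝ) →ₗ[ℝ] (I → ℝ) :=
    { toFun := fun f p => f p - T.mulVec f p + t ⬝ᵥ f
      map_add' := by
        intro a b; ext p
        simp only [Matrix.mulVec_add, dotProduct_add, Pi.add_apply]; ring
      map_smul' := by
        intro a b; ext p
        simp only [Matrix.mulVec_smul, dotProduct_smul, Pi.smul_apply, smul_eq_mul,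
          RingHom.id_apply]
        ring }
  have hdot : ∀ f : I → ℝ, t ⬝ᵥ K f = t ⬝ᵥ f := by
    intro f
    have : K f = f - T.mulVec f + fun _ => t ⬝ᵥ f := rfl
    have hone : t ⬝ᵥ (fun _ => t ⬝ᵥ f) = t ⬝ᵥ f := by
      simp only [dotProduct]
      rw [← Finset.sum_mul, ht.sum_eq_one, one_mul]
    rw [this, dotProduct_add, dotProduct_sub, ht.dotProduct_mulVec, sub_self, zero_add, hone]
  have hinj : Function.Injective K := by
    rw [injective_iff_map_eq_zero]
    intro a ha
    have h0 : t ⬝ᵥ a = 0 := by rw [← hdot, ha, dotProduct_zero]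
    have hh : T.mulVec a = a := by
      ext p
      have := congrFun ha p
      change a p - T.mulVec a p + t ⬝ᵥ a = 0 at this
      linarith
    ext p
    have h1 : t ⬝ᵥ a = a p := by
      simp only [dotProduct]
      rw [Finset.sum_congr rfl fun q _ => by rw [hc.harmonic_const hT hh q p], ← Finset.sum_mul,
        ht.sum_eq_one, one_mul]
    rw [← h1, h0, Pi.zero_apply]
  obtain ⟨h, hh⟩ := (LinearMap.injective_iff_surjective.1 hinj) f
  refine ⟨h, fun p => ?_⟩
  have h1 : t ⬝ᵥ f = t ⬝ᵥ h := by rw [← hh, hdot]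
  have h2 : h p - T.mulVec h p + t ⬝ᵥ h = f p := congrFun hh p
  rw [h1, ← h2]; ring

/-- Pairing the Poisson equation for `t` with `t'` kills its right-hand side, so `t'` and `t` agree
on every `f`. -/
theorem Matrix.OnlyTrivialClosed.stationary_unique (hc : T.OnlyTrivialClosed)
    (hT : T ∈ Matrix.rowStochastic ℝ I) {t t' : I → ℝ} (ht : IsStationaryProbVec T t)
    (ht' : IsStationaryProbVec T t') : t' = t := by
  refine dotProduct_eq _ _ fun f => ?_
  obtain ⟨h, hh⟩ := hc.exists_poisson hT ht f
  have h1 : t' ⬝ᵥ (fun p => f p - t ⬝ᵥ f) = t' ⬝ᵥ (h - T.mulVec h) :=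
    congrArg _ (funext hh)
  rw [dotProduct_sub, ht'.dotProduct_mulVec, sub_self] at h1
  have h2 : t' ⬝ᵥ (fun p => f p - t ⬝ᵥ f) = t' ⬝ᵥ f - t ⬝ᵥ f := by
    simp only [dotProduct, mul_sub, Finset.sum_sub_distrib]
    rw [← Finset.sum_mul, ht'.sum_eq_one, one_mul]
  linarith

/-- The constant vector is a right fixed vector, so there is a nonzero left fixed vector `v`.
Entrywise `|v| ≤ |v| T`, and both sides have the same total mass, so `|v|` is itself fixed; it
remains to normalize. -/
theorem Matrix.exists_isStationaryProbVec [Nonempty I] (hT : T ∈ Matrix.rowStochastic ℝ I) :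
    ∃ t, IsStationaryProbVec T t := by
  have hdet : (1 - T).det = 0 := by
    rw [← Matrix.exists_mulVec_eq_zero_iff]
    refine ⟨1, one_ne_zero, ?_⟩
    rw [Matrix.sub_mulVec, Matrix.one_mulVec, Matrix.one_vecMul_of_mem_rowStochastic hT, sub_self]
  obtain ⟨v, hv, hvT⟩ := Matrix.exists_vecMul_eq_zero_iff.2 hdet
  have hvT : v = Matrix.vecMul v T := by
    rwa [Matrix.vecMul_sub, Matrix.vecMul_one, sub_eq_zero] at hvT
  have hle : ∀ q, |v q| ≤ ∑ p, |v p| * T p q := by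
    intro q
    have h1 : v q = ∑ p, v p * T p q := congrFun hvT q
    rw [h1]
    refine (Finset.abs_sum_le_sum_abs _ _).trans (le_of_eq (Finset.sum_congr rfl fun p _ => ?_))
    rw [abs_mul, abs_of_nonneg (Matrix.nonneg_of_mem_rowStochastic hT)]
  have hsum : ∑ q, |v q| = ∑ q, ∑ p, |v p| * T p q := by
    rw [Finset.sum_comm]
    refine Finset.sum_congr rfl fun p _ => ?_
    rw [← Finset.mul_sum, Matrix.sum_row_of_mem_rowStochastic hT, mul_one]
  have heq := (Finset.sum_eq_sum_iff_of_le fun q _ => hle q).1 hsum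
  have hpos : 0 < ∑ q, |v q| := by
    obtain ⟨p, hp⟩ := Function.ne_iff.1 hv
    exact Finset.sum_pos' (fun q _ => abs_nonneg _) ⟨p, Finset.mem_univ p, abs_pos.2 hp⟩
  refine ⟨fun p => (∑ q, |v q|)⁻¹ * |v p|, fun p => by positivity, ?_, ?_⟩
  · rw [← Finset.mul_sum, inv_mul_cancel₀ hpos.ne']
  · ext q
    simp only [Matrix.vecMul, dotProduct, mul_assoc]
    rw [← Finset.mul_sum, ← heq q (Finset.mem_univ q)]

end StochasticMatrix

/-! ### A strong law for bounded orthogonal random variables. -/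

section StrongLaw

variable {Ω : Type*} [MeasurableSpace Ω] {μ : Measure Ω} [IsProbabilityMeasure μ]
  {D : ℕ → Ω → ℝ} {C : ℝ}

theorem integral_sum_sq_le_of_orthogonal (hm : ∀ i, Measurable (D i))
    (hb : ∀ i ω, |D i ω| ≤ C) (ho : ∀ i j, i < j → ∫ ω, D i ω * D j ω ∂μ = 0) (n : ℕ) :
    Integrable (fun ω => (∑ i ∈ Finset.range n, D i ω) ^ 2) μ ∧
      ∫ ω, (∑ i ∈ Finset.range n, D i ω) ^ 2 ∂μ ≤ n * C ^ 2 := by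
  have hC : ∀ i ω, |D i ω| ≤ |C| := fun i ω => (hb i ω).trans (le_abs_self C)
  have hint : ∀ i j, Integrable (fun ω => D i ω * D j ω) μ := by
    intro i j
    refine Integrable.of_bound ((hm i).mul (hm j)).aestronglyMeasurable (|C| * |C|)
      (ae_of_all _ fun ω => ?_)
    rw [Real.norm_eq_abs, abs_mul]
    exact mul_le_mul (hC i ω) (hC j ω) (abs_nonneg _) (abs_nonneg _)
  induction n with
  | zero => simp
  | succ n ih =>
    have hcross : Integrable (fun ω => (∑ i ∈ Finset.range n, D i ω) * D n ω) μ := by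
      simp only [Finset.sum_mul]
      exact integrable_finsetSum _ fun i _ => hint i n
    have hcross0 : ∫ ω, (∑ i ∈ Finset.range n, D i ω) * D n ω ∂μ = 0 := by
      simp only [Finset.sum_mul]
      rw [integral_finsetSum _ fun i _ => hint i n]
      exact Finset.sum_eq_zero fun i hi => ho i n (Finset.mem_range.1 hi)
    have hexp : (fun ω => (∑ i ∈ Finset.range (n + 1), D i ω) ^ 2) = fun ω =>
        ((∑ i ∈ Finset.range n, D i ω) ^ 2 + 2 * ((∑ i ∈ Finset.range n, D i ω) * D n ω))
          + D n ω * D n ω := by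
      ext ω; rw [Finset.sum_range_succ]; ring
    have h1 : Integrable (fun ω => (∑ i ∈ Finset.range n, D i ω) ^ 2 +
        2 * ((∑ i ∈ Finset.range n, D i ω) * D n ω)) μ := ih.1.add (hcross.const_mul 2)
    have hlast : ∫ ω, D n ω * D n ω ∂μ ≤ C ^ 2 := by
      have := integral_mono (hint n n) (integrable_const (μ := μ) (C ^ 2)) (fun ω => by
        have h2 : |D n ω| ^ 2 ≤ C ^ 2 := pow_le_pow_left₀ (abs_nonneg _) (hb n ω) 2
        rw [sq_abs] at h2
        change D n ω * D n ω ≤ C ^ 2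
        rw [← pow_two]; exact h2)
      simpa using this
    rw [hexp]
    refine ⟨h1.add (hint n n), ?_⟩
    rw [integral_add h1 (hint n n), integral_add ih.1 (hcross.const_mul 2),
      integral_const_mul, hcross0]
    push_cast
    linarith [ih.2]

/-- Strong law of large numbers for uniformly bounded, pairwise orthogonal random variables. -/
theorem ae_tendsto_average_of_orthogonal (hm : ∀ i, Measurable (D i))
    (hb : ∀ i ω, |D i ω| ≤ C) (ho : ∀ i j, i < j → ∫ ω, D i ω * D j ω ∂μ = 0) :
    ∀ᵐ ω ∂μ, Tendsto (fun n : ℕ => (∑ i ∈ Finset.range n, D i ω) / n) atTop (𝓝 0) := by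
  have hsm : ∀ n, Measurable fun ω => ∑ i ∈ Finset.range n, D i ω :=
    fun n => Finset.measurable_sum _ fun i _ => hm i
  -- Along the squares the second moment of the average is at most `C ^ 2 / n ^ 2`, which is
  -- summable. So the squared averages are almost surely summable, and tend to zero.
  let Z : ℕ → Ω → ENNReal := fun n ω =>
    ENNReal.ofReal (((∑ i ∈ Finset.range (n ^ 2), D i ω) / (n ^ 2 : ℕ)) ^ 2)
  have hZm : ∀ n, Measurable (Z n) := fun n =>
    (((hsm (n ^ 2)).div_const _).pow_const 2).ennreal_ofReal
  have hZ : ∀ n, ∫⁻ ω, Z n ω ∂μ ≤ ENNReal.ofReal (C ^ 2 * (1 / (n : ℝ) ^ 2)) := by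
    intro n
    obtain ⟨hi, hle⟩ := integral_sum_sq_le_of_orthogonal hm hb ho (n ^ 2)
    have hi' : Integrable
        (fun ω => ((∑ i ∈ Finset.range (n ^ 2), D i ω) / (n ^ 2 : ℕ)) ^ 2) μ := by
      simp only [div_pow]; exact hi.div_const _
    rw [← ofReal_integral_eq_lintegral_ofReal hi' (ae_of_all _ fun ω => sq_nonneg _)]
    refine ENNReal.ofReal_le_ofReal ?_
    simp only [div_pow]
    rw [integral_div]
    rcases Nat.eq_zero_or_pos n with rfl | hn
    · simp
    · have hn' : (0 : ℝ) < n := by exact_mod_cast hn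
      rw [div_le_iff₀ (by positivity)]
      refine hle.trans (le_of_eq ?_)
      push_cast
      field_simp
  have hfin : ∫⁻ ω, ∑' n, Z n ω ∂μ ≠ ⊤ := by
    rw [lintegral_tsum fun n => (hZm n).aemeasurable]
    refine ne_top_of_le_ne_top ?_ (ENNReal.tsum_le_tsum hZ)
    exact ((Real.summable_one_div_nat_pow.2 one_lt_two).mul_left (C ^ 2)).tsum_ofReal_ne_top
  have hae := ae_lt_top (Measurable.tsum hZm) hfin
  filter_upwards [hae] with ω hω
  have h0 := ENNReal.tendsto_atTop_zero_of_tsum_ne_top hω.ne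
  have h1 : Tendsto (fun n : ℕ => ((∑ i ∈ Finset.range (n ^ 2), D i ω) / (n ^ 2 : ℕ)) ^ 2)
      atTop (𝓝 0) := by
    have := (ENNReal.tendsto_toReal ENNReal.zero_ne_top).comp h0
    refine Tendsto.congr (fun n => ?_) this
    exact ENNReal.toReal_ofReal (sq_nonneg _)
  have h2 : Tendsto (fun n : ℕ => (∑ i ∈ Finset.range (n ^ 2), D i ω) / (n ^ 2 : ℕ))
      atTop (𝓝 0) := by
    rw [tendsto_zero_iff_abs_tendsto_zero]
    have := h1.sqrt
    simpa only [Real.sqrt_sq_eq_abs, Real.sqrt_zero, Function.comp_def] using this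
  have hshift : ∀ n : ℕ, n ≠ 0 →
      (∑ i ∈ Finset.range n, (D i ω + C)) / n = (∑ i ∈ Finset.range n, D i ω) / n + C := by
    intro n hn
    have : (n : ℝ) ≠ 0 := by exact_mod_cast hn
    rw [Finset.sum_add_distrib, add_div, Finset.sum_const, Finset.card_range, nsmul_eq_mul]
    field_simp
  have hsq : Tendsto (fun n : ℕ => n ^ 2) atTop atTop := tendsto_pow_atTop two_ne_zero
  -- Adding `C` makes the summands nonnegative and the partial sums monotone. Convergence along the
  -- squares then extends to all `n`, since ratios of consecutive squares tend to `1`.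
  have h3 : Tendsto (fun n : ℕ => (∑ i ∈ Finset.range n, (D i ω + C)) / n) atTop (𝓝 C) := by
    refine tendsto_div_of_monotone_of_exists_subseq_tendsto_div
      (fun n => ∑ i ∈ Finset.range n, (D i ω + C)) C ?_ ?_
    · refine monotone_nat_of_le_succ fun n => ?_
      rw [Finset.sum_range_succ]
      linarith [neg_le_of_abs_le (hb n ω)]
    · intro a ha
      refine ⟨fun n => n ^ 2, ?_, hsq, ?_⟩
      · have hlim : Tendsto (fun n : ℕ => (1 + 1 / (n : ℝ)) ^ 2) atTop (𝓝 ((1 + 0) ^ 2)) :=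
          (tendsto_one_div_atTop_nhds_zero_nat.const_add 1).pow 2
        have hev := hlim.eventually_lt_const (show ((1 : ℝ) + 0) ^ 2 < a by simpa using ha)
        filter_upwards [hev, eventually_gt_atTop 0] with n hn hn0
        have hn' : (0 : ℝ) < n := by exact_mod_cast hn0
        have : (((n + 1) ^ 2 : ℕ) : ℝ) = (1 + 1 / (n : ℝ)) ^ 2 * ((n ^ 2 : ℕ) : ℝ) := by
          push_cast; field_simp
        rw [this]
        exact mul_le_mul_of_nonneg_right hn.le (by positivity)
      · have := h2.add_const C
        rw [zero_add] at this
        refine this.congr' ?_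
        filter_upwards [eventually_gt_atTop 0] with n hn
        exact (hshift (n ^ 2) (by positivity)).symm
  have h4 := h3.sub_const C
  rw [sub_self] at h4
  refine h4.congr' ?_
  filter_upwards [eventually_gt_atTop 0] with n hn
  rw [hshift n hn.ne']; ring

end StrongLaw

/-! ### The chain of configurations and its transition matrix. -/

noncomputable section

namespace MealyAutomaton

variable {X S : Type*}

/-- The state of the automaton after reading the first `n` letters of `ω`. -/
def run (A : MealyAutomaton X S) (g : S) (ω : ℕ → X) : ℕ → S
  | 0 => g
  | n + 1 => A.trans (A.run g ω n) (ω n)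

/-- The pair formed by the current state and the next input letter. -/
def config (A : MealyAutomaton X S) (g : S) (ω : ℕ → X) (n : ℕ) : S × X :=
  (A.run g ω n, ω n)

theorem run_succ_eq (A : MealyAutomaton X S) (g : S) (ω : ℕ → X) (n : ℕ) :
    A.run g ω (n + 1) = A.run (A.trans g (ω 0)) (seqShift ω) n := by
  induction n with
  | zero => rfl
  | succ n ih => rw [run, ih]; rfl

theorem act_eq_out_run (A : MealyAutomaton X S) (g : S) (ω : ℕ → X) (n : ℕ) :
    A.act g ω n = A.out (A.run g ω n) (ω n) := by
  induction n generalizing g ω with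
  | zero => rfl
  | succ n ih => rw [act, ih, run_succ_eq]; rfl

theorem run_congr (A : MealyAutomaton X S) (g : S) {ω ω' : ℕ → X} {n : ℕ}
    (h : ∀ j < n, ω j = ω' j) : A.run g ω n = A.run g ω' n := by
  induction n with
  | zero => rfl
  | succ n ih => rw [run, run, ih fun j hj => h j (hj.trans n.lt_succ_self), h n n.lt_succ_self]

theorem config_congr (A : MealyAutomaton X S) (g : S) {ω ω' : ℕ → X} {n : ℕ}
    (h : ∀ j ≤ n, ω j = ω' j) : A.config g ω n = A.config g ω' n := by
  rw [config, config, A.run_congr g fun j hj => h j hj.le, h n le_rfl]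

/-- The word `xwy` traces a walk of configurations along allowed transitions. The last letter `y` is
never read: it is the pending letter of the final configuration. -/
theorem transWord_closed (A : MealyAutomaton X S) (L : Matrix X X ℝ) {P : S × X → Prop}
    (hP : ∀ s x y, P (s, x) → L x y ≠ 0 → P (A.trans s x, y)) (w : List X) (s : S) (x y : X)
    (hs : P (s, x)) (hw : (x :: (w ++ [y])).IsChain (fun a b => L a b ≠ 0)) :
    P (A.transWord s (x :: w), y) := by
  induction w generalizing s x with
  | nil =>
    rw [List.nil_append, List.isChain_cons_cons] at hw
    exact hP s x y hs hw.1
  | cons z w ih =>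
    rw [List.cons_append, List.isChain_cons_cons] at hw
    exact ih (A.trans s x) z (hP s x z hs hw.1) hw.2

variable [DecidableEq S]

theorem LStronglyConnected.onlyTrivialClosed {A : MealyAutomaton X S} {L : Matrix X X ℝ}
    (hA : A.LStronglyConnected L) : (A.skewMatrix L).OnlyTrivialClosed := by
  rintro P hP ⟨s, x⟩ ⟨r, y⟩ hs
  obtain ⟨w, hw, hc⟩ := hA s r x y
  rw [← hw]
  refine A.transWord_closed L (fun s x y h hL => hP _ _ h ?_) w s x y hs hc
  simpa [skewMatrix] using hL

variable [Fintype X] [Fintype S]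

theorem skewMatrix_mulVec (A : MealyAutomaton X S) (L : Matrix X X ℝ) (h : S × X → ℝ)
    (p : S × X) :
    (A.skewMatrix L).mulVec h p = ∑ y, L p.2 y * h (A.trans p.1 p.2, y) := by
  simp only [Matrix.mulVec, dotProduct, skewMatrix, Matrix.of_apply, Fintype.sum_prod_type,
    ite_mul, zero_mul]
  rw [Finset.sum_comm]
  refine Finset.sum_congr rfl fun y _ => ?_
  rw [Finset.sum_ite_eq]
  simp

theorem skewMatrix_mem_rowStochastic [DecidableEq X] (A : MealyAutomaton X S)
    {L : Matrix X X ℝ} (hL : L ∈ Matrix.rowStochastic ℝ X) :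
    A.skewMatrix L ∈ Matrix.rowStochastic ℝ (S × X) := by
  refine ⟨fun p q => ?_, ?_⟩
  · rw [skewMatrix, Matrix.of_apply]
    split_ifs
    exacts [Matrix.nonneg_of_mem_rowStochastic hL, le_rfl]
  · ext p
    rw [skewMatrix_mulVec]
    simp [Matrix.sum_row_of_mem_rowStochastic hL]

end MealyAutomaton

/-! ### Integrals of functions of finitely many letters against a Markov measure. -/

section Markov

variable {X : Type*}

/-- A sequence that extends a finite word. -/
def extendWord {n : ℕ} (x : Fin (n + 1) → X) : ℕ → X := fun j => x ⟨min j n, by omega⟩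

theorem extendWord_of_le {n : ℕ} (x : Fin (n + 1) → X) {j : ℕ} (h : j ≤ n) :
    extendWord x j = x ⟨j, Nat.lt_succ_of_le h⟩ := by
  simp only [extendWord, min_eq_left h]

theorem DependsOn.eq_extendWord {n : ℕ} {F : (ℕ → X) → ℝ} (hF : DependsOn F (Set.Iic n))
    (ω : ℕ → X) : F ω = F (extendWord fun i : Fin (n + 1) => ω i) :=
  hF fun j hj => by rw [extendWord_of_le _ hj]

theorem measurable_prefix [MeasurableSpace X] (n : ℕ) :
    Measurable fun (ω : ℕ → X) (i : Fin (n + 1)) => ω i :=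
  measurable_pi_lambda _ fun i => measurable_pi_apply (i : ℕ)

theorem transitionWeight_nonneg {L : Matrix X X ℝ} (hL : ∀ x y, 0 ≤ L x y) {m : ℕ} (x : Fin (m + 1) → X) :
    0 ≤ transitionWeight L x :=
  Finset.prod_nonneg fun _ _ => hL _ _

variable [Fintype X] [MeasurableSpace X] [MeasurableSingletonClass X]

theorem DependsOn.measurable {n : ℕ} {F : (ℕ → X) → ℝ} (hF : DependsOn F (Set.Iic n)) :
    Measurable F := by
  have : F = (fun x : Fin (n + 1) → X => F (extendWord x)) ∘ fun ω i => ω i :=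
    funext fun ω => hF.eq_extendWord ω
  rw [this]
  exact (measurable_of_finite _).comp (measurable_prefix n)

variable {l : X → ℝ} {L : Matrix X X ℝ} {μ : Measure (ℕ → X)} [IsProbabilityMeasure μ]

theorem IsMarkovMeasure.integral_eq (hμ : IsMarkovMeasure l L μ) (hl : ∀ x, 0 ≤ l x)
    (hL : ∀ x y, 0 ≤ L x y) {n : ℕ} {F : (ℕ → X) → ℝ} (hF : DependsOn F (Set.Iic n)) :
    ∫ ω, F ω ∂μ = ∑ x : Fin (n + 1) → X, l (x 0) * transitionWeight L x * F (extendWord x) := by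
  have hm := measurable_prefix (X := X) n
  have : IsProbabilityMeasure (μ.map fun ω (i : Fin (n + 1)) => ω i) :=
    Measure.isProbabilityMeasure_map hm.aemeasurable
  have h1 : ∫ ω, F ω ∂μ =
      ∫ x, F (extendWord x) ∂(μ.map fun ω (i : Fin (n + 1)) => ω i) := by
    rw [integral_map hm.aemeasurable (measurable_of_finite _).aestronglyMeasurable]
    exact integral_congr_ae (ae_of_all _ hF.eq_extendWord)
  rw [h1, integral_fintype .of_finite]
  refine Finset.sum_congr rfl fun x _ => ?_
  have h2 : (fun (ω : ℕ → X) (i : Fin (n + 1)) => ω i) ⁻¹' {x} = wordCylinder x := by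
    ext ω; simp [wordCylinder, funext_iff]
  rw [Measure.real, Measure.map_apply hm (measurableSet_singleton x), h2, hμ,
    ENNReal.toReal_ofReal (mul_nonneg (hl _) (transitionWeight_nonneg hL x)), smul_eq_mul]

/-- The sum in `h0` is the conditional mean of `F` given the letters up to index `n`; the integral
vanishes once the sum over the last letter is carried out first. -/
theorem IsMarkovMeasure.integral_eq_zero [DecidableEq X] (hμ : IsMarkovMeasure l L μ)
    (hl : ∀ x, 0 ≤ l x) (hL : ∀ x y, 0 ≤ L x y) {n : ℕ} {F : (ℕ → X) → ℝ}
    (hF : DependsOn F (Set.Iic (n + 1)))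
    (h0 : ∀ ω : ℕ → X, ∑ y, L (ω n) y * F (Function.update ω (n + 1) y) = 0) :
    ∫ ω, F ω ∂μ = 0 := by
  rw [hμ.integral_eq hl hL hF, ← (Fin.snocEquiv fun _ => X).sum_comp, Fintype.sum_prod_type,
    Finset.sum_comm]
  refine Finset.sum_eq_zero fun x _ => ?_
  rw [← mul_zero (l (x 0) * transitionWeight L x), ← h0 (extendWord x), Finset.mul_sum]
  refine Finset.sum_congr rfl fun y _ => ?_
  have hext : F (extendWord (Fin.snoc (α := fun _ => X) x y)) =
      F (Function.update (extendWord x) (n + 1) y) := by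
    refine hF fun j hj => ?_
    rw [extendWord_of_le _ hj]
    rcases Nat.lt_or_eq_of_le (Set.mem_Iic.1 hj) with h | rfl
    · rw [Function.update_of_ne h.ne, extendWord_of_le _ (Nat.le_of_lt_succ h)]
      exact Fin.snoc_castSucc (α := fun _ => X) y x ⟨j, h⟩
    · rw [Function.update_self]
      exact Fin.snoc_last (α := fun _ => X) y x
  have hw : transitionWeight L (Fin.snoc (α := fun _ => X) x y) =
      transitionWeight L x * L (extendWord x n) y := by
    rw [transitionWeight, Fin.prod_univ_castSucc, extendWord_of_le _ le_rfl]
    congr 1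
    · refine Finset.prod_congr rfl fun i _ => ?_
      rw [Fin.snoc_castSucc, ← Fin.castSucc_succ, Fin.snoc_castSucc]
    · rw [Fin.snoc_castSucc, Fin.succ_last, Fin.snoc_last]
      rfl
  have h00 : Fin.snoc (α := fun _ => X) x y 0 = x 0 := by
    rw [← Fin.castSucc_zero, Fin.snoc_castSucc]
  simp only [Fin.snocEquiv, Equiv.coe_fn_mk]
  rw [hext, hw, h00]
  ring

end Markov

/-! ### Martingale differences along the configurations. -/

namespace MealyAutomaton

variable {X S : Type*} [Fintype X] [Fintype S] [DecidableEq S]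
  {L : Matrix X X ℝ} (A : MealyAutomaton X S) (g : S)

theorem dependsOn_increment {n : ℕ} {G : (ℕ → X) → ℝ} (hG : DependsOn G (Set.Iic n))
    (h : S × X → ℝ) :
    DependsOn (fun ω => G ω * (h (A.config g ω (n + 1)) -
      (A.skewMatrix L).mulVec h (A.config g ω n))) (Set.Iic (n + 1)) := by
  intro ω ω' hω
  have hω' : ∀ j ≤ n, ω j = ω' j := fun j hj => hω j (Set.mem_Iic.2 (hj.trans n.le_succ))
  change G ω * (h (A.config g ω (n + 1)) - (A.skewMatrix L).mulVec h (A.config g ω n)) =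
    G ω' * (h (A.config g ω' (n + 1)) - (A.skewMatrix L).mulVec h (A.config g ω' n))
  rw [hG hω', A.config_congr g hω', A.config_congr g (n := n + 1) hω]

variable [DecidableEq X] [MeasurableSpace X] [MeasurableSingletonClass X] {l : X → ℝ} {μ : Measure (ℕ → X)}
  [IsProbabilityMeasure μ]

/-- The letters up to index `n` determine the state at time `n + 1`, and the letter there has
conditional law `L (ω n) ·`. Hence `h` at time `n + 1` has conditional mean `T h` at time `n`. -/
theorem integral_mul_increment (hμ : IsMarkovMeasure l L μ) (hl : ∀ x, 0 ≤ l x)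
    (hL : L ∈ Matrix.rowStochastic ℝ X) {n : ℕ} {G : (ℕ → X) → ℝ}
    (hG : DependsOn G (Set.Iic n)) (h : S × X → ℝ) :
    ∫ ω, G ω * (h (A.config g ω (n + 1)) -
      (A.skewMatrix L).mulVec h (A.config g ω n)) ∂μ = 0 := by
  refine hμ.integral_eq_zero hl (fun x y => hL.1 x y) (A.dependsOn_increment g hG h) fun ω => ?_
  have hup : ∀ y, ∀ j ≤ n, Function.update ω (n + 1) y j = ω j := fun y j hj =>
    Function.update_of_ne (Nat.lt_succ_of_le hj).ne _ _
  have hterm : ∀ y, L (ω n) y * (G (Function.update ω (n + 1) y) *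
      (h (A.config g (Function.update ω (n + 1) y) (n + 1)) -
        (A.skewMatrix L).mulVec h (A.config g (Function.update ω (n + 1) y) n))) =
      G ω * (L (ω n) y * h (A.run g ω (n + 1), y) -
        L (ω n) y * (A.skewMatrix L).mulVec h (A.config g ω n)) := by
    intro y
    rw [hG (hup y), A.config_congr g (hup y), config,
      A.run_congr g (fun j hj => hup y j (Nat.le_of_lt_succ hj)), Function.update_self]
    ring
  rw [Finset.sum_congr rfl fun y _ => hterm y, ← Finset.mul_sum, Finset.sum_sub_distrib,
    ← Finset.sum_mul, Matrix.sum_row_of_mem_rowStochastic hL, one_mul, skewMatrix_mulVec]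
  simp [config, run]

/-- The offset `k` lets the weight `G i` look `k` letters beyond time `i`, as is needed for treating
an output word letter by letter. -/
theorem ae_tendsto_average_increment (hμ : IsMarkovMeasure l L μ) (hl : ∀ x, 0 ≤ l x)
    (hL : L ∈ Matrix.rowStochastic ℝ X) (k : ℕ) {G : ℕ → (ℕ → X) → ℝ} {B : ℝ}
    (hG : ∀ i, DependsOn (G i) (Set.Iic (i + k))) (hB : ∀ i ω, |G i ω| ≤ B) (h : S × X → ℝ) :
    ∀ᵐ ω ∂μ, Tendsto (fun n : ℕ => (∑ i ∈ Finset.range n, G i ω *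
      (h (A.config g ω (i + k + 1)) - (A.skewMatrix L).mulVec h (A.config g ω (i + k)))) / n)
      atTop (𝓝 0) := by
  have hdep := fun i => A.dependsOn_increment (L := L) g (hG i) h
  let M := ∑ p, ∑ q, |h q - (A.skewMatrix L).mulVec h p|
  have hM : ∀ p q, |h q - (A.skewMatrix L).mulVec h p| ≤ M := fun p q =>
    (Finset.single_le_sum (f := fun q => |h q - (A.skewMatrix L).mulVec h p|)
      (fun _ _ => abs_nonneg _) (Finset.mem_univ q)).trans
    (Finset.single_le_sum (f := fun p => ∑ q, |h q - (A.skewMatrix L).mulVec h p|)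
      (fun _ _ => Finset.sum_nonneg fun _ _ => abs_nonneg _) (Finset.mem_univ p))
  refine ae_tendsto_average_of_orthogonal (C := B * M) (fun i => (hdep i).measurable)
    (fun i ω => ?_) (fun i j hij => ?_)
  · rw [abs_mul]
    exact mul_le_mul (hB i ω) (hM _ _) (abs_nonneg _) ((abs_nonneg _).trans (hB i ω))
  · simp only [← mul_assoc]
    -- As `i < j`, the whole `i`-th term depends only on letters up to `i + k + 1 ≤ j + k`, so it
    -- joins `G j` as a weight for the `j`-th increment.
    refine A.integral_mul_increment g hμ hl hL (G := fun ω => G i ω *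
      (h (A.config g ω (i + k + 1)) - (A.skewMatrix L).mulVec h (A.config g ω (i + k))) * G j ω)
      (fun ω ω' hω => ?_) h
    exact congrArg₂ (· * ·)
      (hdep i fun a ha => hω a (Set.mem_Iic.2 ((Set.mem_Iic.1 ha).trans (by omega)))) (hG j hω)

end MealyAutomaton

/-! ### Output probabilities and sums over Moore paths. -/

namespace MealyAutomaton

section OutputProb

variable {X S : Type*} [Fintype X] [Fintype S] [DecidableEq X] [DecidableEq S]

/-- The probability that the automaton outputs the word `u` when started in a configuration and fed
with letters chosen according to `L`. -/
def outputProb (A : MealyAutomaton X S) (L : Matrix X X ℝ) :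
    (m : ℕ) → (Fin (m + 1) → X) → S × X → ℝ
  | 0, u, p => if A.out p.1 p.2 = u 0 then 1 else 0
  | m + 1, u, p =>
    (if A.out p.1 p.2 = u 0 then 1 else 0) *
      (A.skewMatrix L).mulVec (outputProb A L m (Fin.tail u)) p

omit [Fintype X] [Fintype S] [DecidableEq X] [DecidableEq S] in
theorem isMoorePath_cons (A : MealyAutomaton X S) {k : ℕ} (s₀ : S) (x₀ : X)
    (s : Fin (k + 1) → S) (x : Fin k → X) (u : Fin (k + 1) → X) :
    A.IsMoorePath (Fin.cons s₀ s : Fin (k + 2) → S) (Fin.cons x₀ x : Fin (k + 1) → X) u ↔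
      A.trans s₀ x₀ = s 0 ∧ A.out s₀ x₀ = u 0 ∧ A.IsMoorePath s x (Fin.tail u) := by
  simp only [IsMoorePath, Fin.forall_fin_succ (n := k), Fin.castSucc_zero, Fin.cons_zero,
    Fin.cons_succ, ← Fin.succ_castSucc, Fin.tail, and_assoc]

theorem transitionWeight_cons {X : Type*} (L : Matrix X X ℝ) {m : ℕ} (x₀ : X)
    (x : Fin (m + 1) → X) :
    transitionWeight L (Fin.cons x₀ x : Fin (m + 2) → X) =
      L x₀ (x 0) * transitionWeight L x := by
  rw [transitionWeight, Fin.prod_univ_succ]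
  simp [transitionWeight]

/-- Induction on the word length removes the first edge of each path. The vector `F` is arbitrary
because the induction replaces it by its image under one step of `T` restricted to output `u 0`, and
this image need not be stationary. -/
theorem moorePathSum_eq_sum (A : MealyAutomaton X S) (L : Matrix X X ℝ) {m : ℕ}
    (F : S × X → ℝ) (u : Fin (m + 1) → X) :
    A.moorePathSum L F u = ∑ p, F p * A.outputProb L m u p := by
  classical
  have hsplit : ∀ (n : ℕ) (H : (Fin (n + 2) → S) × (Fin (n + 1) → X) → ℝ), ∑ p, H p =
      ∑ p : S × X, ∑ q : (Fin (n + 1) → S) × (Fin n → X),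
        H (Fin.cons p.1 q.1, Fin.cons p.2 q.2) := by
    intro n H
    rw [← Fintype.sum_prod_type', ← (Equiv.prodProdProdComm S X (Fin (n + 1) → S)
      (Fin n → X)).symm.sum_comp, ← ((Fin.consEquiv fun _ : Fin (n + 2) => S).prodCongr
      (Fin.consEquiv fun _ : Fin (n + 1) => X)).sum_comp]
    rfl
  induction m generalizing F with
  | zero =>
    rw [moorePathSum, Finset.sum_filter, hsplit]
    refine Finset.sum_congr rfl fun p _ => ?_
    -- For a one-letter word only the final state is left to sum over, and the transition function
    -- forces it.
    rw [← (Equiv.prodUnique (Fin 1 → S) (Fin 0 → X)).symm.sum_comp,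
      ← (Equiv.funUnique (Fin 1) S).symm.sum_comp]
    simp only [isMoorePath_cons, outputProb]
    by_cases h : A.out p.1 p.2 = u 0
    · simp [h, IsMoorePath, transitionWeight]
    · simp [h]
  | succ m ih =>
    have hF : ∑ p, F p * A.outputProb L (m + 1) u p = A.moorePathSum L (fun q => ∑ p,
        F p * (if A.out p.1 p.2 = u 0 then 1 else 0) * A.skewMatrix L p q) (Fin.tail u) := by
      rw [ih]
      simp only [outputProb, Matrix.mulVec, dotProduct, Finset.sum_mul, Finset.mul_sum]
      rw [Finset.sum_comm]
      refine Finset.sum_congr rfl fun q _ => Finset.sum_congr rfl fun p _ => by ring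
    rw [hF, moorePathSum, moorePathSum, Finset.sum_filter, Finset.sum_filter, hsplit,
      Finset.sum_comm]
    refine Finset.sum_congr rfl fun q _ => ?_
    simp only [isMoorePath_cons, transitionWeight_cons, Fin.cons_zero]
    by_cases hq : A.IsMoorePath q.1 q.2 (Fin.tail u)
    · simp only [hq, and_true, if_true, Finset.sum_mul, skewMatrix, Matrix.of_apply]
      refine Finset.sum_congr rfl fun p _ => ?_
      by_cases h1 : A.trans p.1 p.2 = q.1 0 <;> by_cases h2 : A.out p.1 p.2 = u 0 <;>
        simp [h1, h2, mul_assoc]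
    · simp [hq]

end OutputProb

/-! ### Almost sure frequencies of configurations and of output words. -/

variable {X S : Type*} [Fintype X] [DecidableEq X] [Fintype S] [DecidableEq S]
  [MeasurableSpace X] [MeasurableSingletonClass X] {L : Matrix X X ℝ} {l : X → ℝ}
  {μ : Measure (ℕ → X)} [IsProbabilityMeasure μ] (A : MealyAutomaton X S) (g : S)

/-- By the Poisson equation the sum of `f` along the run is a martingale sum, plus `n * (t ⬝ᵥ f)`,
plus a bounded telescoping term. -/
theorem ae_tendsto_average_config (hμ : IsMarkovMeasure l L μ) (hl : ∀ x, 0 ≤ l x)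
    (hL : L ∈ Matrix.rowStochastic ℝ X) (hA : A.LStronglyConnected L) {t : S × X → ℝ}
    (ht : IsStationaryProbVec (A.skewMatrix L) t) (f : S × X → ℝ) :
    ∀ᵐ ω ∂μ, Tendsto (fun n : ℕ => (∑ i ∈ Finset.range n, f (A.config g ω i)) / n) atTop
      (𝓝 (t ⬝ᵥ f)) := by
  obtain ⟨h, hh⟩ :=
    hA.onlyTrivialClosed.exists_poisson (A.skewMatrix_mem_rowStochastic hL) ht f
  filter_upwards [A.ae_tendsto_average_increment g hμ hl hL 0 (G := fun _ _ => 1) (B := 1)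
    (fun _ _ _ _ => rfl) (fun _ _ => by simp) h] with ω hω
  have hsum : ∀ n, ∑ i ∈ Finset.range n, f (A.config g ω i) =
      ∑ i ∈ Finset.range n, 1 * (h (A.config g ω (i + 0 + 1)) -
        (A.skewMatrix L).mulVec h (A.config g ω (i + 0))) + n * (t ⬝ᵥ f) +
        (h (A.config g ω 0) - h (A.config g ω n)) := by
    intro n
    induction n with
    | zero => simp
    | succ n ih =>
      rw [Finset.sum_range_succ, Finset.sum_range_succ, ih]
      have := hh (A.config g ω n)
      push_cast
      simp only [add_zero]
      linarith
  have hbdd : Tendsto (fun n : ℕ => (h (A.config g ω 0) - h (A.config g ω n)) / n) atTop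
      (𝓝 0) := by
    refine squeeze_zero_norm (a := fun n : ℕ => (2 * ∑ p, |h p|) / n) (fun n => ?_)
      (tendsto_const_div_atTop_nhds_zero_nat _)
    have hle : ∀ p, |h p| ≤ ∑ p, |h p| := fun p =>
      Finset.single_le_sum (f := fun p => |h p|) (fun _ _ => abs_nonneg _) (Finset.mem_univ p)
    rw [Real.norm_eq_abs, abs_div, Nat.abs_cast]
    refine div_le_div_of_nonneg_right ?_ n.cast_nonneg
    refine (abs_sub _ _).trans ?_
    linarith [hle (A.config g ω 0), hle (A.config g ω n)]
  have := (hω.add hbdd).add_const (t ⬝ᵥ f)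
  rw [add_zero, zero_add] at this
  refine this.congr' ?_
  filter_upwards [eventually_gt_atTop 0] with n hn
  have hn' : (n : ℝ) ≠ 0 := by exact_mod_cast hn.ne'
  rw [hsum]
  field_simp
  ring

open Classical in
/-- Occurrences of `u` in the output are asymptotically as frequent as predicted by the
configuration in which they start. -/
theorem ae_tendsto_average_occurrence (hμ : IsMarkovMeasure l L μ) (hl : ∀ x, 0 ≤ l x)
    (hL : L ∈ Matrix.rowStochastic ℝ X) {m : ℕ} (u : Fin (m + 1) → X) (k : ℕ)
    {G : ℕ → (ℕ → X) → ℝ} {B : ℝ} (hG : ∀ i, DependsOn (G i) (Set.Iic (i + k)))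
    (hB : ∀ i ω, |G i ω| ≤ B) :
    ∀ᵐ ω ∂μ, Tendsto (fun n : ℕ => (∑ i ∈ Finset.range n, G i ω *
      ((if ∀ j : Fin (m + 1), A.act g ω (i + k + j) = u j then 1 else 0) -
        A.outputProb L m u (A.config g ω (i + k)))) / n) atTop (𝓝 0) := by
  induction m generalizing k G with
  | zero =>
    -- A single output letter is a function of the configuration, so each difference is exactly
    -- zero.
    refine ae_of_all _ fun ω => ?_
    refine tendsto_const_nhds.congr fun n => ?_
    rw [Finset.sum_eq_zero, zero_div]
    intro i _
    by_cases h : A.out (A.run g ω (i + k)) (ω (i + k)) = u 0 <;>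
      simp [outputProb, act_eq_out_run, config, h]
  | succ m ih =>
    -- The test on the first output letter is absorbed into the weight. What remains is the same
    -- problem for the tail of `u` at offset `k + 1`, plus the martingale difference of the tail's
    -- `outputProb`.
    let G' : ℕ → (ℕ → X) → ℝ := fun i ω => G i ω *
      (if A.out (A.config g ω (i + k)).1 (A.config g ω (i + k)).2 = u 0 then 1 else 0)
    have hG' : ∀ i, DependsOn (G' i) (Set.Iic (i + k)) := by
      intro i ω ω' hω
      simp only [G']
      rw [hG i hω, A.config_congr g (n := i + k) hω]
    have hB' : ∀ i ω, |G' i ω| ≤ B := by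
      intro i ω
      simp only [G']
      split_ifs
      · rw [mul_one]; exact hB i ω
      · rw [mul_zero, abs_zero]; exact (abs_nonneg _).trans (hB i ω)
    have h1 := ih (Fin.tail u) (k + 1) (G := G')
      (fun i ω ω' hω => hG' i fun j hj => hω j
        (Set.mem_Iic.2 ((Set.mem_Iic.1 hj).trans (by omega)))) hB'
    have h2 := A.ae_tendsto_average_increment g hμ hl hL k hG' hB'
      (A.outputProb L m (Fin.tail u))
    filter_upwards [h1, h2] with ω hω1 hω2
    have := hω1.add hω2
    rw [add_zero] at this
    refine this.congr fun n => ?_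
    rw [← add_div, ← Finset.sum_add_distrib]
    congr 1
    refine Finset.sum_congr rfl fun i _ => ?_
    have hocc : (∀ j : Fin (m + 2), A.act g ω (i + k + j) = u j) ↔
        A.out (A.config g ω (i + k)).1 (A.config g ω (i + k)).2 = u 0 ∧
          ∀ j : Fin (m + 1), A.act g ω (i + (k + 1) + j) = Fin.tail u j := by
      rw [Fin.forall_fin_succ]
      refine and_congr ?_ (forall_congr' fun j => ?_)
      · rw [Fin.val_zero, add_zero, act_eq_out_run]; rfl
      · rw [Fin.val_succ, Fin.tail, show i + k + (j + 1 : ℕ) = i + (k + 1) + j by omega]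
    simp only [G', hocc, outputProb, ← add_assoc]
    by_cases h : A.out (A.config g ω (i + k)).1 (A.config g ω (i + k)).2 = u 0
    · simp only [h, true_and, if_true]; ring
    · simp [h]

end MealyAutomaton

theorem seqShift_iterate {X : Type*} (ω : ℕ → X) (i j : ℕ) : seqShift^[i] ω j = ω (i + j) := by
  induction i generalizing ω with
  | zero => simp
  | succ i ih => rw [Function.iterate_succ_apply, ih, seqShift]; congr 1; omega

end

theorem theorem4p6 {X S : Type*} [Fintype X] [DecidableEq X] [Fintype S] [DecidableEq S]
    [MeasurableSpace X] [MeasurableSingletonClass X]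
    (L : Matrix X X ℝ) (hL : L ∈ Matrix.rowStochastic ℝ X) (hirr : L.IsIrreducible)
    (l : X → ℝ) (hl : IsStationaryProbVec L l)
    (μ : Measure (ℕ → X)) [IsProbabilityMeasure μ] (hμ : IsMarkovMeasure l L μ)
    (A : MealyAutomaton X S) (hA : A.LStronglyConnected L) (g : S) :
    (∃! t : S × X → ℝ, IsStationaryProbVec (A.skewMatrix L) t) ∧
      ∀ t : S × X → ℝ, IsStationaryProbVec (A.skewMatrix L) t →
        ∀ (m : ℕ) (u : Fin (m + 1) → X),
          ∀ᵐ ω ∂μ, HasWordFreq (A.act g ω) u (A.moorePathSum L t u) := by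
  classical
  have hT := A.skewMatrix_mem_rowStochastic hL
  refine ⟨?_, fun t ht m u => ?_⟩
  -- Any sequence supplies a letter, so `S × X` is nonempty.
  · obtain ⟨ω⟩ := nonempty_of_isProbabilityMeasure μ
    have : Nonempty (S × X) := ⟨(g, ω 0)⟩
    obtain ⟨t, ht⟩ := Matrix.exists_isStationaryProbVec hT
    exact ⟨t, ht, fun t' ht' => hA.onlyTrivialClosed.stationary_unique hT ht ht'⟩
  · filter_upwards [A.ae_tendsto_average_occurrence g hμ hl.nonneg hL u 0 (G := fun _ _ => 1)
      (B := 1) (fun _ _ _ _ => rfl) (fun _ _ => by simp),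
      A.ae_tendsto_average_config g hμ hl.nonneg hL hA ht (A.outputProb L m u)] with ω h1 h2
    have := h1.add h2
    rw [zero_add] at this
    rw [HasWordFreq, A.moorePathSum_eq_sum]
    refine this.congr fun n => ?_
    rw [← add_div, ← Finset.sum_add_distrib, birkhoffAverage, birkhoffSum, smul_eq_mul,
      div_eq_inv_mul]
    congr 1
    refine Finset.sum_congr rfl fun i _ => ?_
    simp only [Set.indicator_apply, wordCylinder, Set.mem_ofPred_eq, seqShift_iterate, add_zero]
    ring
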